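/- A real Banach lattice $X$ has the positive Schur property (PSP) if every sequence of positive elements of $X$ that converges weakly to $0$ converges to $0$ in norm. For Banach lattices $E_1, E_2, F$ with $F$ Dedekind complete (every nonempty subset of $F$ that is bounded above has a supremum), let $\mathcal{L}^r(E_1,E_2;F)$ be the space of regular bilinear operators $T\colon E_1\times E_2\to F$, that is, differences of two positive bilinear operators (a bilinear operator $P$ is positive if $P(x,y)\ge 0$ whenever $x,y\ge 0$). It is ordered by $S\le T$ if and only if $T-S$ is positive, and it is normed by the regular norm $\|T\|_r=\|\,|T|\,\|$, where $|T|=T\vee(-T)$ and the outer norm is the operator norm for bilinear operators; with these it is a Banach lattice. For a Banach lattice $E$ let $E^*$ be its topological dual with the dual norm and the order in which $\varphi\ge 0$ if and only if $\varphi(x)\ge 0$ for all $x\ge 0$. Theorem. Let $E_1, E_2, F$ be nonzero real Banach lattices with $F$ Dedekind complete. Then $\mathcal{L}^r(E_1,E_2;F)$ has the PSP if and only if $E_1^*$, $E_2^*$ and $F$ all have the PSP. -/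

import Mathlib

open Filter Topology

set_option maxSynthPendingDepth 3
set_option linter.unusedSectionVars false

/-- A (real) Banach lattice: a vector lattice with a complete lattice norm
(`|x| ≤ |y|` implies `‖x‖ ≤ ‖y‖`). -/
class IsBanachLattice (E : Type*) [NormedAddCommGroup E] [NormedSpace ℝ E] [Lattice E] : Prop
    extends IsOrderedAddMonoid E, IsOrderedModule ℝ E, HasSolidNorm E, CompleteSpace E

/-- Dedekind completeness: every nonempty set that is bounded above has a supremum. -/
class IsDedekindComplete (F : Type*) [PartialOrder F] : Prop where
  exists_isLUB : ∀ s : Set F, s.Nonempty → BddAbove s → ∃ b, IsLUB s b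

/-- The positive Schur property: every weakly null sequence of positive elements is norm null.
Weakly null means that `φ (u n) → 0` for every `φ` in the topological dual. -/
def HasPSP (X : Type*) [NormedAddCommGroup X] [NormedSpace ℝ X] [PartialOrder X] : Prop :=
  ∀ u : ℕ → X, (∀ n, 0 ≤ u n) →
    (∀ φ : StrongDual ℝ X, Tendsto (fun n => φ (u n)) atTop (𝓝 0)) →
    Tendsto u atTop (𝓝 0)

section RieszKantorovich

variable {E : Type*} [AddCommGroup E] [Module ℝ E] [Lattice E] [IsOrderedAddMonoid E]
  [IsOrderedModule ℝ E]

/-- A linear map on a vector lattice is determined by its values on the positive cone. -/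
theorem LinearMap.ext_of_nonneg {G : Type*} [AddCommGroup G] [Module ℝ G] {S T : E →ₗ[ℝ] G}
    (h : ∀ x, 0 ≤ x → S x = T x) : S = T := by
  ext x
  rw [← posPart_sub_negPart x, map_sub, map_sub, h _ (posPart_nonneg x), h _ (negPart_nonneg x)]

/-- The order of the topological dual: `φ ≤ ψ` if and only if `φ x ≤ ψ x` for all `x ≥ 0`. -/
instance StrongDual.instPartialOrderOfCone {E : Type*} [NormedAddCommGroup E] [NormedSpace ℝ E]
    [Lattice E] [IsBanachLattice E] : PartialOrder (StrongDual ℝ E) where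
  le φ ψ := ∀ x, 0 ≤ x → φ x ≤ ψ x
  le_refl φ x _ := le_rfl
  le_trans φ ψ χ h₁ h₂ x hx := (h₁ x hx).trans (h₂ x hx)
  le_antisymm φ ψ h₁ h₂ := by
    have : (φ : E →ₗ[ℝ] ℝ) = ψ :=
      LinearMap.ext_of_nonneg fun x hx => le_antisymm (h₁ x hx) (h₂ x hx)
    ext x
    exact LinearMap.congr_fun this x

variable {G : Type*} [AddCommGroup G] [Module ℝ G]

theorem exists_linearMap_of_cone (m : E → G)
    (hadd : ∀ x y, 0 ≤ x → 0 ≤ y → m (x + y) = m x + m y)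
    (hsmul : ∀ c : ℝ, 0 ≤ c → ∀ x, 0 ≤ x → m (c • x) = c • m x) :
    ∃ L : E →ₗ[ℝ] G, ∀ x, 0 ≤ x → L x = m x := by
  have key : ∀ a b : E, 0 ≤ a → 0 ≤ b → m (a - b)⁺ - m (a - b)⁻ = m a - m b := by
    intro a b ha hb
    have h : (a - b)⁺ + b = a + (a - b)⁻ := by
      have := posPart_sub_negPart (a - b)
      rw [sub_eq_sub_iff_add_eq_add] at this
      exact this
    have h2 := congrArg m h
    rw [hadd _ _ (posPart_nonneg _) hb, hadd _ _ ha (negPart_nonneg _)] at h2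
    rw [sub_eq_sub_iff_add_eq_add]
    exact h2
  have h0 : m 0 = 0 := by simpa using hsmul 0 le_rfl 0 le_rfl
  refine ⟨{ toFun := fun x => m x⁺ - m x⁻, map_add' := ?_, map_smul' := ?_ }, ?_⟩
  · intro x y
    have h : x + y = (x⁺ + y⁺) - (x⁻ + y⁻) := by
      conv_lhs => rw [← posPart_sub_negPart x, ← posPart_sub_negPart y]
      abel
    have hp : ∀ z : E, 0 ≤ z⁺ := posPart_nonneg
    have hn : ∀ z : E, 0 ≤ z⁻ := negPart_nonneg
    have := key (x⁺ + y⁺) (x⁻ + y⁻) (add_nonneg (hp x) (hp y)) (add_nonneg (hn x) (hn y))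
    rw [← h, hadd _ _ (hp x) (hp y), hadd _ _ (hn x) (hn y)] at this
    rw [this]
    abel
  · intro c x
    have hp : 0 ≤ x⁺ := posPart_nonneg x
    have hn : 0 ≤ x⁻ := negPart_nonneg x
    rcases le_total 0 c with hc | hc
    · have := key (c • x⁺) (c • x⁻) (smul_nonneg hc hp) (smul_nonneg hc hn)
      rw [← smul_sub, posPart_sub_negPart, hsmul c hc _ hp, hsmul c hc _ hn, ← smul_sub] at this
      exact this
    · have hc' : 0 ≤ -c := neg_nonneg.2 hc
      have := key ((-c) • x⁻) ((-c) • x⁺) (smul_nonneg hc' hn) (smul_nonneg hc' hp)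
      rw [← smul_sub, hsmul _ hc' _ hp, hsmul _ hc' _ hn, ← smul_sub] at this
      have e : (-c) • (x⁻ - x⁺) = c • x := by
        rw [neg_smul, ← smul_neg, neg_sub, posPart_sub_negPart]
      rw [e, neg_smul, ← smul_neg, neg_sub] at this
      exact this
  · intro x hx
    simp [posPart_of_nonneg hx, negPart_of_nonneg hx, h0]

/-- `RieszSum A x g`: `g = ∑ Tᵢ xᵢ` for some finite families `Tᵢ ∈ A` and `xᵢ ≥ 0` with
`∑ xᵢ = x`. -/
inductive RieszSum (A : Set (E →ₗ[ℝ] G)) : E → G → Prop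
  | zero : RieszSum A 0 0
  | cons (T : E →ₗ[ℝ] G) (u x : E) (g : G) : T ∈ A → 0 ≤ u → RieszSum A x g →
      RieszSum A (u + x) (T u + g)

theorem RieszSum.nonneg {A : Set (E →ₗ[ℝ] G)} {x : E} {g : G} (h : RieszSum A x g) : 0 ≤ x := by
  induction h with
  | zero => exact le_rfl
  | cons T u x g _ hu _ ih => exact add_nonneg hu ih

theorem RieszSum.add {A : Set (E →ₗ[ℝ] G)} {x y : E} {f g : G} (h : RieszSum A x f)
    (h' : RieszSum A y g) : RieszSum A (x + y) (f + g) := by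
  induction h with
  | zero => simpa using h'
  | cons T u x f hT hu _ ih =>
    rw [add_assoc, add_assoc]
    exact .cons T u _ _ hT hu ih

theorem RieszSum.smul {A : Set (E →ₗ[ℝ] G)} {x : E} {f : G} (h : RieszSum A x f)
    {c : ℝ} (hc : 0 ≤ c) : RieszSum A (c • x) (c • f) := by
  induction h with
  | zero => simpa using RieszSum.zero (A := A)
  | cons T u x f hT hu _ ih =>
    rw [smul_add, smul_add, ← map_smul]
    exact .cons T _ _ _ hT (smul_nonneg hc hu) ih

theorem RieszSum.split {A : Set (E →ₗ[ℝ] G)} {z : E} {h : G} (hz : RieszSum A z h) :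
    ∀ x y : E, 0 ≤ x → 0 ≤ y → z = x + y →
      ∃ f g, RieszSum A x f ∧ RieszSum A y g ∧ h = f + g := by
  induction hz with
  | zero =>
    intro x y hx hy e
    have hx0 : x = 0 := le_antisymm (by rw [e]; exact le_add_of_nonneg_right hy) hx
    have hy0 : y = 0 := by rw [hx0, zero_add] at e; exact e.symm
    subst hx0 hy0
    exact ⟨0, 0, .zero, .zero, by simp⟩
  | cons T u z h hT hu hz ih =>
    intro x y hx hy e
    have h1 : 0 ≤ u ⊓ x := le_inf hu hx
    have h2 : 0 ≤ u - u ⊓ x := sub_nonneg.2 inf_le_left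
    have h3 : 0 ≤ x - u ⊓ x := sub_nonneg.2 inf_le_right
    have h4 : 0 ≤ y - (u - u ⊓ x) := by
      rw [sub_nonneg, sub_le_comm]
      refine le_inf (sub_le_self _ hy) ?_
      rw [sub_le_iff_le_add, ← e]
      exact le_add_of_nonneg_right hz.nonneg
    obtain ⟨f, g, hf, hg, hfg⟩ := ih _ _ h3 h4 (by
      have : z = x + y - u := by rw [← e]; abel
      rw [this]; abel)
    refine ⟨T (u ⊓ x) + f, T (u - u ⊓ x) + g, ?_, ?_, ?_⟩
    · have := RieszSum.cons T _ _ _ hT h1 hf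
      rwa [add_sub_cancel] at this
    · have := RieszSum.cons T _ _ _ hT h2 hg
      rwa [add_sub_cancel] at this
    · rw [hfg, map_sub]; abel

theorem RieszSum.le [PartialOrder G] [IsOrderedAddMonoid G] {A : Set (E →ₗ[ℝ] G)} {x : E} {f : G}
    (h : RieszSum A x f) {U : E →ₗ[ℝ] G} (hU : ∀ T ∈ A, ∀ x, 0 ≤ x → T x ≤ U x) : f ≤ U x := by
  induction h with
  | zero => simp
  | cons T u x f hT hu _ ih =>
    rw [map_add]
    exact add_le_add (hU T hT u hu) ih

/-- Riesz–Kantorovich: a nonempty set of linear maps that is bounded above has a supremum with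
respect to the order given by the positive cone of `E`. -/
theorem exists_lub_linearMap [PartialOrder G] [IsOrderedAddMonoid G] [PosSMulMono ℝ G]
    [IsDedekindComplete G] (A : Set (E →ₗ[ℝ] G)) (hA : A.Nonempty) (S : E →ₗ[ℝ] G)
    (hS : ∀ T ∈ A, ∀ x, 0 ≤ x → T x ≤ S x) :
    ∃ L : E →ₗ[ℝ] G, (∀ T ∈ A, ∀ x, 0 ≤ x → T x ≤ L x) ∧
      ∀ U : E →ₗ[ℝ] G, (∀ T ∈ A, ∀ x, 0 ≤ x → T x ≤ U x) → ∀ x, 0 ≤ x → L x ≤ U x := by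
  obtain ⟨T₀, hT₀⟩ := hA
  have single : ∀ T ∈ A, ∀ x, 0 ≤ x → RieszSum A x (T x) := by
    intro T hT x hx
    simpa using RieszSum.cons T x 0 0 hT hx .zero
  have hex : ∀ x : E, ∃ b, 0 ≤ x → IsLUB {g | RieszSum A x g} b := by
    intro x
    by_cases hx : 0 ≤ x
    · obtain ⟨b, hb⟩ := IsDedekindComplete.exists_isLUB {g | RieszSum A x g}
        ⟨_, single T₀ hT₀ x hx⟩ ⟨S x, fun g hg => RieszSum.le hg hS⟩
      exact ⟨b, fun _ => hb⟩
    · exact ⟨0, fun h => absurd h hx⟩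
  choose m hm using hex
  have hadd : ∀ x y, 0 ≤ x → 0 ≤ y → m (x + y) = m x + m y := by
    intro x y hx hy
    apply le_antisymm
    · refine (hm _ (add_nonneg hx hy)).2 fun h hh => ?_
      obtain ⟨f, g, hf, hg, rfl⟩ := RieszSum.split hh x y hx hy rfl
      exact add_le_add ((hm x hx).1 hf) ((hm y hy).1 hg)
    · rw [← le_sub_iff_add_le]
      refine (hm x hx).2 fun f hf => ?_
      rw [le_sub_comm]
      refine (hm y hy).2 fun g hg => ?_
      rw [le_sub_iff_add_le, add_comm]
      exact (hm _ (add_nonneg hx hy)).1 (RieszSum.add hf hg)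
  have hle : ∀ c : ℝ, 0 < c → ∀ x, 0 ≤ x → m (c • x) ≤ c • m x := by
    intro c hc x hx
    refine (hm _ (smul_nonneg hc.le hx)).2 fun f hf => ?_
    have h1 := RieszSum.smul hf (inv_nonneg.2 hc.le)
    rw [inv_smul_smul₀ hc.ne'] at h1
    have h2 := smul_le_smul_of_nonneg_left ((hm x hx).1 h1) hc.le
    rwa [smul_inv_smul₀ hc.ne'] at h2
  have hsmul : ∀ c : ℝ, 0 ≤ c → ∀ x, 0 ≤ x → m (c • x) = c • m x := by
    intro c hc x hx
    rcases hc.eq_or_lt with rfl | hc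
    · have := hadd 0 0 le_rfl le_rfl
      simp at this
      simp [this]
    · refine le_antisymm (hle c hc x hx) ?_
      have h1 := hle c⁻¹ (inv_pos.2 hc) (c • x) (smul_nonneg hc.le hx)
      rw [inv_smul_smul₀ hc.ne'] at h1
      have h2 := smul_le_smul_of_nonneg_left h1 hc.le
      rwa [smul_inv_smul₀ hc.ne'] at h2
  obtain ⟨L, hL⟩ := exists_linearMap_of_cone m hadd hsmul
  refine ⟨L, fun T hT x hx => ?_, fun U hU x hx => ?_⟩
  · rw [hL x hx]
    exact (hm x hx).1 (single T hT x hx)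
  · rw [hL x hx]
    exact (hm x hx).2 fun f hf => RieszSum.le hf hU

end RieszKantorovich

section Regular

variable {E₁ E₂ F : Type*}
  [NormedAddCommGroup E₁] [NormedSpace ℝ E₁] [Lattice E₁]
  [NormedAddCommGroup E₂] [NormedSpace ℝ E₂] [Lattice E₂]
  [NormedAddCommGroup F] [NormedSpace ℝ F] [Lattice F]

/-- A bilinear map `T : E₁ × E₂ → F` is positive if `T (x, y) ≥ 0` whenever `x, y ≥ 0`. -/
def IsPositiveBilinear (T : E₁ →ₗ[ℝ] E₂ →ₗ[ℝ] F) : Prop :=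
  ∀ x y, 0 ≤ x → 0 ≤ y → 0 ≤ T x y

variable [IsBanachLattice E₁] [IsBanachLattice E₂] [IsBanachLattice F]

variable (E₁ E₂ F) in
/-- The vector space of regular bilinear maps: the differences of two positive bilinear maps. -/
def regularBilinear : Submodule ℝ (E₁ →ₗ[ℝ] E₂ →ₗ[ℝ] F) where
  carrier := {T | ∃ P Q, IsPositiveBilinear P ∧ IsPositiveBilinear Q ∧ T = P - Q}
  zero_mem' := ⟨0, 0, fun _ _ _ _ => le_rfl, fun _ _ _ _ => le_rfl, by simp⟩
  add_mem' := by
    rintro _ _ ⟨P, Q, hP, hQ, rfl⟩ ⟨P', Q', hP', hQ', rfl⟩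
    exact ⟨P + P', Q + Q', fun x y hx hy => add_nonneg (hP x y hx hy) (hP' x y hx hy),
      fun x y hx hy => add_nonneg (hQ x y hx hy) (hQ' x y hx hy), by abel⟩
  smul_mem' := by
    rintro c _ ⟨P, Q, hP, hQ, rfl⟩
    rcases le_total 0 c with hc | hc
    · exact ⟨c • P, c • Q, fun x y hx hy => smul_nonneg hc (hP x y hx hy),
        fun x y hx hy => smul_nonneg hc (hQ x y hx hy), smul_sub _ _ _⟩
    · have hc' : 0 ≤ -c := neg_nonneg.2 hc
      exact ⟨(-c) • Q, (-c) • P, fun x y hx hy => smul_nonneg hc' (hQ x y hx hy),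
        fun x y hx hy => smul_nonneg hc' (hP x y hx hy), by module⟩

variable (E₁ E₂ F) in
/-- The space `L^r(E₁, E₂; F)` of regular bilinear operators. -/
def RegularBilinear : Type _ := ↥(regularBilinear E₁ E₂ F)

namespace RegularBilinear

instance instAddCommGroup : AddCommGroup (RegularBilinear E₁ E₂ F) :=
  inferInstanceAs (AddCommGroup ↥(regularBilinear E₁ E₂ F))

instance instModule : Module ℝ (RegularBilinear E₁ E₂ F) :=
  inferInstanceAs (Module ℝ ↥(regularBilinear E₁ E₂ F))

variable (E₁ E₂ F) in
/-- The inclusion of the regular bilinear operators into all bilinear maps. -/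
def toBilinear : RegularBilinear E₁ E₂ F →ₗ[ℝ] E₁ →ₗ[ℝ] E₂ →ₗ[ℝ] F :=
  (regularBilinear E₁ E₂ F).subtype

/-- The value `T (x, y)` is written `T x y`. -/
instance instCoeFun : CoeFun (RegularBilinear E₁ E₂ F) fun _ => E₁ → E₂ → F where
  coe T x y := toBilinear E₁ E₂ F T x y

theorem ext_bilinear {S T : RegularBilinear E₁ E₂ F}
    (h : toBilinear E₁ E₂ F S = toBilinear E₁ E₂ F T) : S = T :=
  (regularBilinear E₁ E₂ F).injective_subtype h

theorem add_apply (S T : RegularBilinear E₁ E₂ F) (x : E₁) (y : E₂) :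
    (S + T) x y = S x y + T x y := rfl

theorem smul_apply (c : ℝ) (T : RegularBilinear E₁ E₂ F) (x : E₁) (y : E₂) :
    (c • T) x y = c • T x y := rfl

theorem zero_apply (x : E₁) (y : E₂) : (0 : RegularBilinear E₁ E₂ F) x y = 0 := rfl

/-- The order: `S ≤ T` if and only if `T - S` is positive. -/
instance instPartialOrder : PartialOrder (RegularBilinear E₁ E₂ F) where
  le S T := ∀ x y, 0 ≤ x → 0 ≤ y → S x y ≤ T x y
  le_refl S x y _ _ := le_rfl
  le_trans S T U h₁ h₂ x y hx hy := (h₁ x y hx hy).trans (h₂ x y hx hy)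
  le_antisymm S T h₁ h₂ := by
    refine ext_bilinear (LinearMap.ext_of_nonneg fun x hx => LinearMap.ext_of_nonneg fun y hy => ?_)
    exact le_antisymm (h₁ x y hx hy) (h₂ x y hx hy)

theorem le_def {S T : RegularBilinear E₁ E₂ F} :
    S ≤ T ↔ ∀ x y, 0 ≤ x → 0 ≤ y → S x y ≤ T x y := Iff.rfl

theorem nonneg_iff {T : RegularBilinear E₁ E₂ F} : 0 ≤ T ↔ IsPositiveBilinear (toBilinear E₁ E₂ F T) := Iff.rfl

instance instIsOrderedAddMonoid : IsOrderedAddMonoid (RegularBilinear E₁ E₂ F) where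
  add_le_add_left S T h U x y hx hy := by
    rw [add_apply, add_apply]
    exact add_le_add_left (h x y hx hy) _

instance instIsOrderedModule : IsOrderedModule ℝ (RegularBilinear E₁ E₂ F) :=
  IsOrderedModule.of_smul_nonneg fun _ hc _ hT => nonneg_iff.2 fun x y hx hy =>
    smul_nonneg hc (nonneg_iff.1 hT x y hx hy)

/-- Two regular bilinear operators have a supremum if the range space is Dedekind complete. -/
theorem exists_isLUB_pair [IsDedekindComplete F] (S T : RegularBilinear E₁ E₂ F) :
    ∃ U, IsLUB {S, T} U := by
  let _ : PartialOrder (E₂ →ₗ[ℝ] F) :=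
    { le := fun f g => ∀ y, 0 ≤ y → f y ≤ g y
      le_refl := fun f y _ => le_rfl
      le_trans := fun f g h h₁ h₂ y hy => (h₁ y hy).trans (h₂ y hy)
      le_antisymm := fun f g h₁ h₂ =>
        LinearMap.ext_of_nonneg fun y hy => le_antisymm (h₁ y hy) (h₂ y hy) }
  have _ : IsOrderedAddMonoid (E₂ →ₗ[ℝ] F) :=
    { add_le_add_left := fun f g h k y hy => by simpa using h y hy }
  have _ : PosSMulMono ℝ (E₂ →ₗ[ℝ] F) :=
    ⟨fun c hc f g h y hy => smul_le_smul_of_nonneg_left (h y hy) hc⟩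
  have _ : IsDedekindComplete (E₂ →ₗ[ℝ] F) :=
    ⟨fun A hA ⟨B, hB⟩ => by
      obtain ⟨L, hL, hL'⟩ := exists_lub_linearMap A hA B (fun f hf => hB hf)
      exact ⟨L, fun f hf => hL f hf, fun U hU => hL' U fun f hf => hU hf⟩⟩
  obtain ⟨P, Q, hP, hQ, hPQ⟩ := S.2
  obtain ⟨P', Q', hP', hQ', hPQ'⟩ := T.2
  obtain ⟨L, hL, hL'⟩ := exists_lub_linearMap {S.1, T.1} ⟨S.1, by simp⟩ (P + P') (by
    rintro R (rfl | rfl) x hx y hy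
    · have h1 := hQ x y hx hy
      have h2 := hP' x y hx hy
      rw [hPQ]
      simp only [LinearMap.sub_apply, LinearMap.add_apply]
      exact (sub_le_self _ h1).trans (le_add_of_nonneg_right h2)
    · have h1 := hQ' x y hx hy
      have h2 := hP x y hx hy
      rw [hPQ']
      simp only [LinearMap.sub_apply, LinearMap.add_apply]
      exact (sub_le_self _ h1).trans (le_add_of_nonneg_left h2))
  have hreg : L ∈ regularBilinear E₁ E₂ F := by
    have h : L - S.1 ∈ regularBilinear E₁ E₂ F :=
      ⟨L - S.1, 0, fun x y hx hy => by
        have := hL S.1 (by simp) x hx y hy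
        simpa using this, fun _ _ _ _ => le_rfl, by simp⟩
    simpa using add_mem h S.2
  refine ⟨⟨L, hreg⟩, ?_, fun U hU => ?_⟩
  · rintro R (rfl | rfl) x y hx hy
    · exact hL R.1 (by simp) x hx y hy
    · exact hL R.1 (by simp) x hx y hy
  · have h := hL' U.1 (by
      rintro R (rfl | rfl) x hx y hy
      · exact hU (show S ∈ ({S, T} : Set _) by simp) x y hx hy
      · exact hU (show T ∈ ({S, T} : Set _) by simp) x y hx hy)
    exact fun x y hx hy => h x hx y hy

/-- The lattice operations of `L^r(E₁, E₂; F)` for Dedekind complete `F`: `S ⊔ T` is the supremum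
of `{S, T}`. In particular, the modulus is `|T| = T ⊔ (-T)`. -/
noncomputable instance instLattice [IsDedekindComplete F] :
    Lattice (RegularBilinear E₁ E₂ F) where
  sup S T := (exists_isLUB_pair S T).choose
  le_sup_left S T := (exists_isLUB_pair S T).choose_spec.1 (by simp)
  le_sup_right S T := (exists_isLUB_pair S T).choose_spec.1 (by simp)
  sup_le S T U h₁ h₂ := (exists_isLUB_pair S T).choose_spec.2 (by
    rintro R (rfl | rfl)
    · exact h₁
    · exact h₂)
  inf S T := -(exists_isLUB_pair (-S) (-T)).choose
  inf_le_left S T := neg_le.1 ((exists_isLUB_pair (-S) (-T)).choose_spec.1 (by simp))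
  inf_le_right S T := neg_le.1 ((exists_isLUB_pair (-S) (-T)).choose_spec.1 (by simp))
  le_inf S T U h₁ h₂ := le_neg.1 ((exists_isLUB_pair (-T) (-U)).choose_spec.2 (by
    rintro R (rfl | rfl)
    · exact neg_le_neg h₁
    · exact neg_le_neg h₂))

theorem norm_apply_le_of_nonneg {P : E₁ →ₗ[ℝ] E₂ →ₗ[ℝ] F} (hP : IsPositiveBilinear P)
    (x : E₁) (y : E₂) : ‖P x y‖ ≤ ‖P |x| |y|‖ := by
  have h1 : ∀ a b : E₂, ∀ z : E₁, 0 ≤ z → a ≤ b → P z a ≤ P z b := by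
    intro a b z hz hab
    have := hP z (b - a) hz (sub_nonneg.2 hab)
    rw [map_sub] at this
    exact sub_nonneg.1 this
  have h2 : ∀ z : E₁, 0 ≤ z → |P z y| ≤ P z |y| := by
    intro z hz
    refine abs_le'.2 ⟨h1 _ _ z hz (le_abs_self y), ?_⟩
    rw [← map_neg]
    exact h1 _ _ z hz (neg_le_abs y)
  apply norm_le_norm_of_abs_le_abs
  refine le_trans ?_ (le_abs_self _)
  have e : P x y = P x⁺ y - P x⁻ y := by
    rw [← LinearMap.sub_apply, ← map_sub, posPart_sub_negPart]
  rw [e, ← posPart_add_negPart x, map_add, LinearMap.add_apply, sub_eq_add_neg]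
  refine (abs_add_le _ _).trans ?_
  rw [abs_neg]
  exact add_le_add (h2 _ (posPart_nonneg x)) (h2 _ (negPart_nonneg x))

/-- Positive bilinear operators between Banach lattices are bounded. -/
theorem exists_bound_of_nonneg {P : E₁ →ₗ[ℝ] E₂ →ₗ[ℝ] F} (hP : IsPositiveBilinear P) :
    ∃ C, ∀ x y, ‖P x y‖ ≤ C * ‖x‖ * ‖y‖ := by
  have hunit : ∃ C : ℝ, ∀ x y, 0 ≤ x → 0 ≤ y → ‖x‖ ≤ 1 → ‖y‖ ≤ 1 → ‖P x y‖ ≤ C := by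
    by_contra hcon
    push Not at hcon
    choose x y hx hy hx1 hy1 hxy using fun n : ℕ => hcon (8 ^ n)
    have hsum : Summable fun n : ℕ => (1 / 2 : ℝ) ^ n := summable_geometric_two
    have hsx : Summable fun n => (1 / 2 : ℝ) ^ n • x n := by
      refine Summable.of_norm_bounded hsum fun n => ?_
      rw [norm_smul, Real.norm_of_nonneg (by positivity)]
      exact mul_le_of_le_one_right (by positivity) (hx1 n)
    have hsy : Summable fun n => (1 / 2 : ℝ) ^ n • y n := by
      refine Summable.of_norm_bounded hsum fun n => ?_
      rw [norm_smul, Real.norm_of_nonneg (by positivity)]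
      exact mul_le_of_le_one_right (by positivity) (hy1 n)
    have hnx : ∀ n, 0 ≤ (1 / 2 : ℝ) ^ n • x n := fun n => smul_nonneg (by positivity) (hx n)
    have hny : ∀ n, 0 ≤ (1 / 2 : ℝ) ^ n • y n := fun n => smul_nonneg (by positivity) (hy n)
    set X := ∑' n, (1 / 2 : ℝ) ^ n • x n
    set Y := ∑' n, (1 / 2 : ℝ) ^ n • y n
    have hX : ∀ n, (1 / 2 : ℝ) ^ n • x n ≤ X := fun n => hsx.le_tsum n fun k _ => hnx k
    have hY : ∀ n, (1 / 2 : ℝ) ^ n • y n ≤ Y := fun n => hsy.le_tsum n fun k _ => hny k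
    have hX0 : 0 ≤ X := (hnx 0).trans (hX 0)
    have hb : ∀ n : ℕ, (2 : ℝ) ^ n ≤ ‖P X Y‖ := by
      intro n
      have h1 : P ((1 / 2 : ℝ) ^ n • x n) ((1 / 2 : ℝ) ^ n • y n) ≤ P X Y := by
        have ha := hP _ _ (sub_nonneg.2 (hX n)) (hny n)
        rw [map_sub, LinearMap.sub_apply, sub_nonneg] at ha
        have hb := hP _ _ hX0 (sub_nonneg.2 (hY n))
        rw [map_sub, sub_nonneg] at hb
        exact ha.trans hb
      have h0 := hP _ _ (hnx n) (hny n)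
      have h2 := norm_le_norm_of_abs_le_abs
        (show |P ((1 / 2 : ℝ) ^ n • x n) ((1 / 2 : ℝ) ^ n • y n)| ≤ |P X Y| by
          rw [abs_of_nonneg h0]
          exact h1.trans (le_abs_self _))
      rw [map_smul, map_smul, LinearMap.smul_apply, norm_smul, norm_smul,
        Real.norm_of_nonneg (by positivity)] at h2
      refine le_trans ?_ h2
      have h3 := (hxy n).le
      calc (2 : ℝ) ^ n = (1 / 2 : ℝ) ^ n * ((1 / 2 : ℝ) ^ n * 8 ^ n) := by
            rw [← mul_pow, ← mul_pow]; norm_num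
        _ ≤ _ := by gcongr
    obtain ⟨n, hn⟩ := pow_unbounded_of_one_lt ‖P X Y‖ (one_lt_two (α := ℝ))
    exact absurd (hb n) (not_le.2 hn)
  obtain ⟨C, hC⟩ := hunit
  refine ⟨C, fun x y => ?_⟩
  refine (norm_apply_le_of_nonneg hP x y).trans ?_
  by_cases hx : ‖x‖ = 0
  · have : x = 0 := norm_eq_zero.1 hx
    subst this; simp
  by_cases hy : ‖y‖ = 0
  · have : y = 0 := norm_eq_zero.1 hy
    subst this; simp
  have hx' : 0 < ‖x‖ := lt_of_le_of_ne (norm_nonneg _) (Ne.symm hx)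
  have hy' : 0 < ‖y‖ := lt_of_le_of_ne (norm_nonneg _) (Ne.symm hy)
  have h := hC (‖x‖⁻¹ • |x|) (‖y‖⁻¹ • |y|) (smul_nonneg (by positivity) (abs_nonneg x))
    (smul_nonneg (by positivity) (abs_nonneg y))
    (by rw [norm_smul, norm_abs_eq_norm, norm_inv, norm_norm, inv_mul_cancel₀ hx])
    (by rw [norm_smul, norm_abs_eq_norm, norm_inv, norm_norm, inv_mul_cancel₀ hy])
  rw [map_smul, map_smul, LinearMap.smul_apply, norm_smul, norm_smul, norm_inv, norm_inv,
    norm_norm, norm_norm, inv_mul_le_iff₀ hy', inv_mul_le_iff₀ hx'] at h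
  linarith [h]

theorem exists_bound (T : RegularBilinear E₁ E₂ F) : ∃ C, ∀ x y, ‖T x y‖ ≤ C * ‖x‖ * ‖y‖ := by
  obtain ⟨P, Q, hP, hQ, h⟩ := T.2
  obtain ⟨C, hC⟩ := exists_bound_of_nonneg hP
  obtain ⟨D, hD⟩ := exists_bound_of_nonneg hQ
  refine ⟨C + D, fun x y => ?_⟩
  have e : T x y = P x y - Q x y := congrArg (fun B : E₁ →ₗ[ℝ] E₂ →ₗ[ℝ] F => B x y) h
  rw [e]
  refine (norm_sub_le _ _).trans ?_
  linarith [hC x y, hD x y]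

/-- A regular bilinear operator as a bounded bilinear operator. -/
noncomputable def toContinuousBilinear (T : RegularBilinear E₁ E₂ F) : E₁ →L[ℝ] E₂ →L[ℝ] F :=
  LinearMap.mkContinuousOfExistsBound₂ (toBilinear E₁ E₂ F T) T.exists_bound

@[simp]
theorem toContinuousBilinear_apply (T : RegularBilinear E₁ E₂ F) (x : E₁) (y : E₂) :
    T.toContinuousBilinear x y = T x y := rfl

theorem opNorm_mono {S T : RegularBilinear E₁ E₂ F} (hS : 0 ≤ S) (h : S ≤ T) :
    ‖S.toContinuousBilinear‖ ≤ ‖T.toContinuousBilinear‖ := by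
  refine ContinuousLinearMap.opNorm_le_bound₂ _ (norm_nonneg T.toContinuousBilinear) fun x y => ?_
  rw [toContinuousBilinear_apply]
  refine (norm_apply_le_of_nonneg hS x y).trans ?_
  have h0 : 0 ≤ S |x| |y| := hS _ _ (abs_nonneg x) (abs_nonneg y)
  have h1 : S |x| |y| ≤ T |x| |y| := h _ _ (abs_nonneg x) (abs_nonneg y)
  have h2 : ‖S |x| |y|‖ ≤ ‖T |x| |y|‖ := norm_le_norm_of_abs_le_abs (by
    rw [abs_of_nonneg h0]
    exact h1.trans (le_abs_self _))
  refine h2.trans ?_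
  have h3 := T.toContinuousBilinear.le_opNorm₂ |x| |y|
  rwa [norm_abs_eq_norm, norm_abs_eq_norm] at h3

variable [IsDedekindComplete F]

/-- The regular norm `‖T‖_r = ‖ |T| ‖`, the operator norm of the modulus of `T`. -/
noncomputable instance instNorm : Norm (RegularBilinear E₁ E₂ F) where
  norm T := ‖(|T|).toContinuousBilinear‖

theorem norm_def (T : RegularBilinear E₁ E₂ F) : ‖T‖ = ‖(|T|).toContinuousBilinear‖ := rfl

theorem normedSpaceCore : NormedSpace.Core ℝ (RegularBilinear E₁ E₂ F) where
  norm_nonneg T := norm_nonneg (|T|).toContinuousBilinear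
  norm_smul c T := by
    have h : ∀ d : ℝ, 0 ≤ d → ∀ S : RegularBilinear E₁ E₂ F, |d • S| ≤ d • |S| := by
      intro d hd S
      refine abs_le'.2 ⟨smul_le_smul_of_nonneg_left (le_abs_self S) hd, ?_⟩
      rw [← smul_neg]
      exact smul_le_smul_of_nonneg_left (neg_le_abs S) hd
    have h' : ∀ d : ℝ, 0 ≤ d → ∀ S : RegularBilinear E₁ E₂ F, |d • S| = d • |S| := by
      intro d hd S
      rcases hd.eq_or_lt with rfl | hd
      · simp
      · refine le_antisymm (h d hd.le S) ?_
        have h1 := smul_le_smul_of_nonneg_left (h d⁻¹ (inv_nonneg.2 hd.le) (d • S)) hd.le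
        rwa [inv_smul_smul₀ hd.ne', smul_inv_smul₀ hd.ne'] at h1
    have h'' : |c • T| = |c| • |T| := by
      rcases abs_cases c with ⟨hc, hc0⟩ | ⟨hc, hc0⟩
      · rw [hc, h' c hc0]
      · rw [hc, ← h' (-c) (neg_nonneg.2 hc0.le), neg_smul, abs_neg]
    have e : (|c| • |T|).toContinuousBilinear = |c| • (|T|).toContinuousBilinear := by
      ext x y
      rfl
    rw [norm_def, norm_def, h'', e, norm_smul, Real.norm_eq_abs, abs_abs, Real.norm_eq_abs]
  norm_triangle S T := by
    rw [norm_def, norm_def, norm_def]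
    exact (opNorm_mono (abs_nonneg (S + T)) (abs_add_le S T)).trans
      (norm_add_le (|S|).toContinuousBilinear (|T|).toContinuousBilinear)
  norm_eq_zero_iff T := by
    rw [norm_def]
    refine (norm_eq_zero (a := (|T|).toContinuousBilinear)).trans ?_
    constructor
    · intro h
      have h' : |T| = 0 := by
        apply ext_bilinear
        ext x y
        exact congrArg (fun B : E₁ →L[ℝ] E₂ →L[ℝ] F => B x y) h
      have h1 : T ≤ 0 := h' ▸ le_abs_self T
      have h2 : -T ≤ 0 := h' ▸ neg_le_abs T
      exact le_antisymm h1 (neg_nonpos.1 h2)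
    · rintro rfl
      rw [abs_zero]
      rfl

noncomputable instance instNormedAddCommGroup : NormedAddCommGroup (RegularBilinear E₁ E₂ F) :=
  NormedAddCommGroup.ofCore normedSpaceCore

noncomputable instance instNormedSpace : NormedSpace ℝ (RegularBilinear E₁ E₂ F) :=
  NormedSpace.ofCore normedSpaceCore

end RegularBilinear

end Regular

section Dual

variable {E : Type*} [NormedAddCommGroup E] [NormedSpace ℝ E] [Lattice E] [IsBanachLattice E]

theorem norm_le_norm_of_nonneg_of_le {x y : E} (hx : 0 ≤ x) (h : x ≤ y) : ‖x‖ ≤ ‖y‖ :=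
  norm_le_norm_of_abs_le_abs (by rwa [abs_of_nonneg hx, abs_of_nonneg (hx.trans h)])

namespace StrongDual

/-- The positive part of a functional, by the Riesz–Kantorovich formula
`φ⁺ x = sup {φ y | 0 ≤ y ≤ x}`. -/
theorem exists_isLUB_image_Icc (φ : StrongDual ℝ E) :
    ∃ ψ : StrongDual ℝ E, ∀ x, 0 ≤ x → IsLUB (φ '' Set.Icc 0 x) (ψ x) := by
  have hbd : ∀ x y, y ∈ Set.Icc 0 x → φ y ≤ ‖φ‖ * ‖x‖ := fun x y hy =>
    (le_abs_self _).trans ((φ.le_opNorm y).trans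
      (mul_le_mul_of_nonneg_left (norm_le_norm_of_nonneg_of_le hy.1 hy.2) (norm_nonneg φ)))
  have hm : ∀ x : E, 0 ≤ x → IsLUB (φ '' Set.Icc 0 x) (sSup (φ '' Set.Icc 0 x)) := fun x hx =>
    isLUB_csSup ⟨φ 0, 0, ⟨le_rfl, hx⟩, rfl⟩
      ⟨‖φ‖ * ‖x‖, by rintro _ ⟨y, hy, rfl⟩; exact hbd x y hy⟩
  set m : E → ℝ := fun x => sSup (φ '' Set.Icc 0 x)
  have hadd : ∀ x y, 0 ≤ x → 0 ≤ y → m (x + y) = m x + m y := by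
    intro x y hx hy
    apply le_antisymm
    · refine (hm _ (add_nonneg hx hy)).2 ?_
      rintro _ ⟨z, ⟨hz0, hz⟩, rfl⟩
      have h1 := (hm x hx).1 ⟨z ⊓ x, ⟨le_inf hz0 hx, inf_le_right⟩, rfl⟩
      have h2 := (hm y hy).1 ⟨z - z ⊓ x, ⟨sub_nonneg.2 inf_le_left, by
        rw [sub_le_comm]
        exact le_inf (sub_le_self _ hy) (sub_le_iff_le_add.2 hz)⟩, rfl⟩
      have e : φ z = φ (z ⊓ x) + φ (z - z ⊓ x) := by rw [← map_add, add_sub_cancel]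
      rw [e]
      exact add_le_add h1 h2
    · rw [← le_sub_iff_add_le]
      refine (hm x hx).2 ?_
      rintro _ ⟨a, ha, rfl⟩
      rw [le_sub_comm]
      refine (hm y hy).2 ?_
      rintro _ ⟨b, hb, rfl⟩
      rw [le_sub_iff_add_le, add_comm, ← map_add]
      exact (hm _ (add_nonneg hx hy)).1
        ⟨a + b, ⟨add_nonneg ha.1 hb.1, add_le_add ha.2 hb.2⟩, rfl⟩
  have hle : ∀ c : ℝ, 0 < c → ∀ x, 0 ≤ x → m (c • x) ≤ c * m x := by
    intro c hc x hx
    refine (hm _ (smul_nonneg hc.le hx)).2 ?_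
    rintro _ ⟨z, ⟨hz0, hz⟩, rfl⟩
    have h1 := smul_le_smul_of_nonneg_left hz (inv_nonneg.2 hc.le)
    rw [inv_smul_smul₀ hc.ne'] at h1
    have h2 := (hm x hx).1 ⟨c⁻¹ • z, ⟨smul_nonneg (inv_nonneg.2 hc.le) hz0, h1⟩, rfl⟩
    rwa [map_smul, smul_eq_mul, inv_mul_le_iff₀ hc] at h2
  have hsmul : ∀ c : ℝ, 0 ≤ c → ∀ x, 0 ≤ x → m (c • x) = c • m x := by
    intro c hc x hx
    rcases hc.eq_or_lt with rfl | hc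
    · have := hadd 0 0 le_rfl le_rfl
      simp only [add_zero, left_eq_add] at this
      simp [this]
    · refine le_antisymm (hle c hc x hx) ?_
      have h1 := hle c⁻¹ (inv_pos.2 hc) (c • x) (smul_nonneg hc.le hx)
      rw [inv_smul_smul₀ hc.ne', le_inv_mul_iff₀ hc] at h1
      exact h1
  obtain ⟨L, hL⟩ := exists_linearMap_of_cone m hadd hsmul
  have hL0 : ∀ x, 0 ≤ x → 0 ≤ L x := fun x hx => by
    rw [hL x hx]
    exact (hm x hx).1 ⟨0, ⟨le_rfl, hx⟩, map_zero φ⟩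
  have hLbd : ∀ x, 0 ≤ x → L x ≤ ‖φ‖ * ‖x‖ := fun x hx => by
    rw [hL x hx]
    refine (hm x hx).2 ?_
    rintro _ ⟨y, hy, rfl⟩
    exact hbd x y hy
  refine ⟨L.mkContinuous ‖φ‖ fun x => ?_, fun x hx => ?_⟩
  · have h1 := hL0 _ (sub_nonneg.2 (le_abs_self x))
    have h2 := hL0 _ (sub_nonneg.2 (neg_le_abs x))
    have h3 := hLbd |x| (abs_nonneg x)
    rw [norm_abs_eq_norm] at h3
    rw [map_sub] at h1 h2
    rw [map_neg] at h2
    rw [Real.norm_eq_abs, abs_le]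
    constructor <;> linarith
  · rw [LinearMap.mkContinuous_apply, hL x hx]
    exact hm x hx

instance instIsOrderedAddMonoid : IsOrderedAddMonoid (StrongDual ℝ E) where
  add_le_add_left _ _ h χ x hx := add_le_add_left (h x hx) (χ x)

/-- The positive part of a functional on a Banach lattice. -/
noncomputable def positivePart (φ : StrongDual ℝ E) : StrongDual ℝ E :=
  (exists_isLUB_image_Icc φ).choose

theorem isLUB_positivePart (φ : StrongDual ℝ E) {x : E} (hx : 0 ≤ x) :
    IsLUB (φ '' Set.Icc 0 x) (positivePart φ x) :=
  (exists_isLUB_image_Icc φ).choose_spec x hx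

theorem positivePart_nonneg (φ : StrongDual ℝ E) : 0 ≤ positivePart φ := fun _ hx =>
  (isLUB_positivePart φ hx).1 ⟨0, ⟨le_rfl, hx⟩, map_zero φ⟩

theorem le_positivePart (φ : StrongDual ℝ E) : φ ≤ positivePart φ := fun x hx =>
  (isLUB_positivePart φ hx).1 ⟨x, ⟨hx, le_rfl⟩, rfl⟩

theorem positivePart_le {φ ψ : StrongDual ℝ E} (h : φ ≤ ψ) (h0 : 0 ≤ ψ) :
    positivePart φ ≤ ψ := fun x hx => (isLUB_positivePart φ hx).2 (by
  rintro _ ⟨y, hy, rfl⟩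
  have h1 : 0 ≤ ψ (x - y) := h0 (x - y) (sub_nonneg.2 hy.2)
  rw [map_sub] at h1
  exact (h y hy.1).trans (sub_nonneg.1 h1))

/-- The dual of a Banach lattice is a vector lattice. -/
noncomputable instance instLattice : Lattice (StrongDual ℝ E) where
  sup φ ψ := positivePart (φ - ψ) + ψ
  le_sup_left φ ψ := sub_le_iff_le_add.1 (le_positivePart (φ - ψ))
  le_sup_right φ ψ := le_add_of_nonneg_left (positivePart_nonneg (φ - ψ))
  sup_le _ ψ _ h₁ h₂ := le_sub_iff_add_le.1
    (positivePart_le (sub_le_sub_right h₁ ψ) (sub_nonneg.2 h₂))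
  inf φ ψ := φ - positivePart (φ - ψ)
  inf_le_left φ ψ := sub_le_self _ (positivePart_nonneg (φ - ψ))
  inf_le_right φ ψ := sub_le_comm.1 (le_positivePart (φ - ψ))
  le_inf _ ψ _ h₁ h₂ := le_sub_comm.1
    (positivePart_le (sub_le_sub_left h₂ ψ) (sub_nonneg.2 h₁))

theorem abs_apply_le (φ : StrongDual ℝ E) (x : E) : |φ x| ≤ |φ| |x| := by
  have h1 := le_abs_self φ x⁺ (posPart_nonneg x)
  have h2 := le_abs_self φ x⁻ (negPart_nonneg x)
  have h3 := neg_le_abs φ x⁺ (posPart_nonneg x)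
  have h4 := neg_le_abs φ x⁻ (negPart_nonneg x)
  rw [neg_apply] at h3 h4
  have e1 : φ x = φ x⁺ - φ x⁻ := by rw [← map_sub, posPart_sub_negPart]
  have e2 : |φ| |x| = |φ| x⁺ + |φ| x⁻ := by rw [← map_add, posPart_add_negPart]
  rw [e1, e2, abs_le]
  constructor <;> linarith

theorem norm_abs_le (φ : StrongDual ℝ E) : ‖|φ|‖ ≤ ‖φ‖ := by
  have hpos : ∀ x, 0 ≤ x → |φ| x ≤ ‖φ‖ * ‖x‖ := by
    intro x hx
    have hle : |φ| ≤ positivePart φ + positivePart φ - φ := by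
      refine abs_le'.2 ⟨?_, ?_⟩
      · exact le_sub_iff_add_le.2 (add_le_add (le_positivePart φ) (le_positivePart φ))
      · rw [le_sub_iff_add_le, neg_add_cancel]
        exact add_nonneg (positivePart_nonneg φ) (positivePart_nonneg φ)
    refine (hle x hx).trans ?_
    have h : positivePart φ x ≤ (‖φ‖ * ‖x‖ + φ x) / 2 := by
      refine (isLUB_positivePart φ hx).2 ?_
      rintro _ ⟨y, hy, rfl⟩
      have h1 : |y + y - x| ≤ |x| := by
        rw [abs_of_nonneg hx]
        refine abs_le'.2 ⟨?_, ?_⟩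
        · rw [sub_le_iff_le_add]
          exact add_le_add hy.2 hy.2
        · rw [neg_sub, sub_le_self_iff]
          exact add_nonneg hy.1 hy.1
      have h2 := (le_abs_self _).trans ((φ.le_opNorm (y + y - x)).trans
        (mul_le_mul_of_nonneg_left (norm_le_norm_of_abs_le_abs h1) (norm_nonneg φ)))
      rw [map_sub, map_add] at h2
      linarith
    rw [sub_apply, add_apply]
    linarith
  refine ContinuousLinearMap.opNorm_le_bound _ (norm_nonneg φ) fun x => ?_
  have h1 := abs_apply_le |φ| x
  rw [abs_abs] at h1
  have h2 := hpos |x| (abs_nonneg x)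
  rw [norm_abs_eq_norm] at h2
  exact h1.trans h2

/-- The dual of a Banach lattice is a Banach lattice. -/
instance instIsBanachLattice : IsBanachLattice (StrongDual ℝ E) where
  toIsOrderedAddMonoid := instIsOrderedAddMonoid
  toIsOrderedModule := IsOrderedModule.of_smul_nonneg fun _ hc _ hφ x hx =>
    mul_nonneg hc (hφ x hx)
  toCompleteSpace := inferInstance
  solid φ ψ h := by
    refine le_trans ?_ (norm_abs_le ψ)
    refine ContinuousLinearMap.opNorm_le_bound _ (norm_nonneg _) fun x => ?_
    refine (abs_apply_le φ x).trans ((h _ (abs_nonneg x)).trans ((le_abs_self _).trans ?_))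
    have := (|ψ|).le_opNorm |x|
    rwa [norm_abs_eq_norm x] at this

/-- On a nonzero Banach lattice there is a nonzero positive functional. -/
theorem exists_pos_ne_zero [Nontrivial E] : ∃ φ : StrongDual ℝ E, 0 ≤ φ ∧ φ ≠ 0 := by
  obtain ⟨φ, hφ⟩ := exists_ne (0 : StrongDual ℝ E)
  refine ⟨|φ|, abs_nonneg φ, fun h => hφ ?_⟩
  rw [← norm_eq_zero, ← norm_abs_eq_norm, h, norm_zero]

end StrongDual

/-- Convergence to `0` needs to be tested on positive functionals only. -/
theorem tendsto_dual_of_nonneg {u : ℕ → E}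
    (h : ∀ φ : StrongDual ℝ E, 0 ≤ φ → Tendsto (fun n => φ (u n)) atTop (𝓝 0))
    (φ : StrongDual ℝ E) : Tendsto (fun n => φ (u n)) atTop (𝓝 0) := by
  have := (h _ (posPart_nonneg φ)).sub (h _ (negPart_nonneg φ))
  simpa only [← sub_apply, posPart_sub_negPart, sub_zero] using this

theorem exists_nonneg_ne_zero [Nontrivial E] : ∃ x : E, 0 ≤ x ∧ x ≠ 0 := by
  obtain ⟨x, hx⟩ := exists_ne (0 : E)
  refine ⟨|x|, abs_nonneg x, fun h => hx ?_⟩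
  rw [← norm_eq_zero, ← norm_abs_eq_norm, h, norm_zero]

end Dual

namespace RegularBilinear

variable {E₁ E₂ F : Type*}
  [NormedAddCommGroup E₁] [NormedSpace ℝ E₁] [Lattice E₁] [IsBanachLattice E₁]
  [NormedAddCommGroup E₂] [NormedSpace ℝ E₂] [Lattice E₂] [IsBanachLattice E₂]
  [NormedAddCommGroup F] [NormedSpace ℝ F] [Lattice F] [IsBanachLattice F]
  [IsDedekindComplete F]

theorem norm_of_nonneg {T : RegularBilinear E₁ E₂ F} (hT : 0 ≤ T) :
    ‖T‖ = ‖T.toContinuousBilinear‖ := by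
  rw [norm_def, abs_of_nonneg hT]

theorem norm_le_of_abs_le {S T : RegularBilinear E₁ E₂ F} (h : |S| ≤ T) : ‖S‖ ≤ ‖T‖ := by
  rw [norm_of_nonneg ((abs_nonneg S).trans h), norm_def]
  exact opNorm_mono (abs_nonneg S) h

theorem norm_toContinuousBilinear_le (T : RegularBilinear E₁ E₂ F) :
    ‖T.toContinuousBilinear‖ ≤ ‖T‖ := by
  refine ContinuousLinearMap.opNorm_le_bound₂ _ (norm_nonneg T) fun x y => ?_
  have hpos : ∀ a b, 0 ≤ a → 0 ≤ b → |T a b| ≤ |T| a b := fun a b ha hb =>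
    abs_le'.2 ⟨le_abs_self T a b ha hb, neg_le_abs T a b ha hb⟩
  have hbd : |T x y| ≤ |T| |x| |y| := by
    have e : T x y = (T x⁺ y⁺ - T x⁺ y⁻) - (T x⁻ y⁺ - T x⁻ y⁻) := by
      rw [← map_sub, ← map_sub, posPart_sub_negPart, ← LinearMap.sub_apply, ← map_sub,
        posPart_sub_negPart]
    have e' : |T| |x| |y| = (|T| x⁺ y⁺ + |T| x⁺ y⁻) + (|T| x⁻ y⁺ + |T| x⁻ y⁻) := by
      rw [← map_add, ← map_add, posPart_add_negPart, ← LinearMap.add_apply, ← map_add,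
        posPart_add_negPart]
    have hs : ∀ a b : F, |a - b| ≤ |a| + |b| := fun a b => by
      rw [sub_eq_add_neg, ← abs_neg b]
      exact abs_add_le a (-b)
    rw [e, e']
    refine (hs _ _).trans (add_le_add ((hs _ _).trans (add_le_add
      (hpos _ _ (posPart_nonneg x) (posPart_nonneg y))
      (hpos _ _ (posPart_nonneg x) (negPart_nonneg y)))) ((hs _ _).trans (add_le_add
      (hpos _ _ (negPart_nonneg x) (posPart_nonneg y))
      (hpos _ _ (negPart_nonneg x) (negPart_nonneg y)))))
  have h1 : ‖T x y‖ ≤ ‖|T| |x| |y|‖ :=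
    norm_le_norm_of_abs_le_abs (hbd.trans (le_abs_self _))
  have h2 := (|T|).toContinuousBilinear.le_opNorm₂ |x| |y|
  rw [norm_abs_eq_norm, norm_abs_eq_norm] at h2
  exact h1.trans h2

variable (E₁ E₂ F) in
/-- The inclusion of the regular bilinear operators into the bounded ones, as a bounded linear
map. -/
noncomputable def toContinuousBilinearCLM :
    RegularBilinear E₁ E₂ F →L[ℝ] E₁ →L[ℝ] E₂ →L[ℝ] F :=
  LinearMap.mkContinuous
    { toFun := toContinuousBilinear
      map_add' := fun _ _ => rfl
      map_smul' := fun _ _ => rfl } 1 fun T => by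
    rw [one_mul]
    exact norm_toContinuousBilinear_le T

theorem exists_nonneg_norm_lt {T : RegularBilinear E₁ E₂ F} (hT : 0 ≤ T) {ε : ℝ} (hε : 0 < ε) :
    ∃ x y, 0 ≤ x ∧ 0 ≤ y ∧ ‖x‖ ≤ 1 ∧ ‖y‖ ≤ 1 ∧ ‖T‖ < ‖T x y‖ + ε := by
  by_contra! hcon
  have hδ : 0 ≤ max (‖T‖ - ε) 0 := le_max_right _ _
  have h : ‖T.toContinuousBilinear‖ ≤ max (‖T‖ - ε) 0 := by
    refine ContinuousLinearMap.opNorm_le_of_unit_norm hδ fun x hx => ?_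
    refine ContinuousLinearMap.opNorm_le_of_unit_norm hδ fun y hy => ?_
    have h1 := hcon |x| |y| (abs_nonneg x) (abs_nonneg y) (by rw [norm_abs_eq_norm, hx])
      (by rw [norm_abs_eq_norm, hy])
    refine le_max_of_le_left ?_
    rw [le_sub_iff_add_le]
    exact le_trans (by gcongr; exact norm_apply_le_of_nonneg hT x y) h1
  rw [← norm_of_nonneg hT] at h
  rcases le_max_iff.1 h with h | h
  · linarith
  · have := hcon 0 0 le_rfl le_rfl (by simp) (by simp)
    have := norm_nonneg (T 0 0)
    linarith

/-- The positive Schur property passes from the duals of `E₁`, `E₂` and from `F` to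
`L^r(E₁, E₂; F)`. -/
theorem hasPSP (h₁ : HasPSP (StrongDual ℝ E₁)) (h₂ : HasPSP (StrongDual ℝ E₂)) (hF : HasPSP F) :
    HasPSP (RegularBilinear E₁ E₂ F) := by
  intro T hT hweak
  choose x y hx hy hx1 hy1 hxy using fun n : ℕ =>
    exists_nonneg_norm_lt (hT n) (Nat.one_div_pos_of_nat (α := ℝ) (n := n))
  have hnull : Tendsto (fun n => T n (x n) (y n)) atTop (𝓝 0) := by
    refine hF _ (fun n => hT n _ _ (hx n) (hy n)) (tendsto_dual_of_nonneg fun f hf => ?_)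
    have hdual : Tendsto (fun n => f.comp (toContinuousBilinearCLM E₁ E₂ F (T n) (x n)))
        atTop (𝓝 0) := by
      refine h₂ _ (fun n b hb => hf _ (hT n _ _ (hx n) hb)) (tendsto_dual_of_nonneg fun g hg => ?_)
      let Φ : RegularBilinear E₁ E₂ F →L[ℝ] StrongDual ℝ E₁ :=
        (ContinuousLinearMap.compL ℝ E₁ (E₂ →L[ℝ] F) ℝ
          (g.comp (ContinuousLinearMap.compL ℝ E₂ F ℝ f))).comp (toContinuousBilinearCLM E₁ E₂ F)
      have hΦ : Tendsto (fun n => Φ (T n)) atTop (𝓝 0) :=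
        h₁ _ (fun n a ha => hg _ fun b hb => hf _ (hT n _ _ ha hb)) fun χ => hweak (χ.comp Φ)
      refine squeeze_zero_norm (fun n => ?_) (tendsto_zero_iff_norm_tendsto_zero.1 hΦ)
      exact (Φ (T n)).unit_le_opNorm (x n) (hx1 n)
    refine squeeze_zero_norm (fun n => ?_) (tendsto_zero_iff_norm_tendsto_zero.1 hdual)
    exact (f.comp (toContinuousBilinearCLM E₁ E₂ F (T n) (x n))).unit_le_opNorm (y n) (hy1 n)
  rw [tendsto_zero_iff_norm_tendsto_zero] at hnull ⊢
  have hlim := hnull.add (tendsto_one_div_add_atTop_nhds_zero_nat (𝕜 := ℝ))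
  rw [add_zero] at hlim
  exact squeeze_zero (fun n => norm_nonneg _) (fun n => (hxy n).le) hlim

/-- The positive Schur property passes from `L^r(E₁, E₂; F)` to a Banach lattice that embeds into
it by a positive map. -/
theorem hasPSP_of_embedding {X : Type*} [NormedAddCommGroup X] [NormedSpace ℝ X] [Lattice X]
    [IsBanachLattice X] (B : X →ₗ[ℝ] E₁ →ₗ[ℝ] E₂ →ₗ[ℝ] F)
    (hpos : ∀ x, 0 ≤ x → IsPositiveBilinear (B x)) {C c : ℝ} (hC : 0 ≤ C)
    (hupper : ∀ x a b, ‖B x a b‖ ≤ C * ‖x‖ * ‖a‖ * ‖b‖)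
    (hlower : ∀ x K, 0 ≤ K → (∀ a b, ‖B x a b‖ ≤ K * ‖a‖ * ‖b‖) → ‖x‖ ≤ c * K)
    (h : HasPSP (RegularBilinear E₁ E₂ F)) : HasPSP X := by
  have hmem : ∀ x, B x ∈ regularBilinear E₁ E₂ F := fun x =>
    ⟨B x⁺, B x⁻, hpos _ (posPart_nonneg x), hpos _ (negPart_nonneg x), by
      rw [← map_sub, posPart_sub_negPart]⟩
  let L : X →ₗ[ℝ] RegularBilinear E₁ E₂ F := B.codRestrict (regularBilinear E₁ E₂ F) hmem
  have hLpos : ∀ x, 0 ≤ x → 0 ≤ L x := hpos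
  have hbd : ∀ x, ‖L x‖ ≤ C * ‖x‖ := by
    intro x
    have habs : |L x| ≤ L |x| := by
      refine abs_le'.2 ⟨?_, ?_⟩
      · rw [← sub_nonneg, ← map_sub]
        exact hLpos _ (sub_nonneg.2 (le_abs_self x))
      · rw [← map_neg, ← sub_nonneg, ← map_sub]
        exact hLpos _ (sub_nonneg.2 (neg_le_abs x))
    refine (norm_le_of_abs_le habs).trans ?_
    rw [norm_of_nonneg (hLpos _ (abs_nonneg x)), ← norm_abs_eq_norm x]
    exact ContinuousLinearMap.opNorm_le_bound₂ _ (by positivity) (hupper |x|)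
  let Λ : X →L[ℝ] RegularBilinear E₁ E₂ F := L.mkContinuous C hbd
  intro u hu hweak
  have hΛ : Tendsto (fun n => Λ (u n)) atTop (𝓝 0) :=
    h _ (fun n => hLpos _ (hu n)) fun χ => hweak (χ.comp Λ)
  refine squeeze_zero_norm (fun n => hlower (u n) ‖Λ (u n)‖ (norm_nonneg _) fun a b => ?_) ?_
  · exact ((toContinuousBilinear (Λ (u n))).le_opNorm₂ a b).trans
      (by gcongr; exact norm_toContinuousBilinear_le _)
  · simpa using (tendsto_zero_iff_norm_tendsto_zero.1 hΛ).const_mul c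

/-- The bilinear map `(x, y) ↦ φ x • ψ y • f` is linear in each of `φ`, `ψ` and `f`. -/
def rankOne : StrongDual ℝ E₁ →ₗ[ℝ] StrongDual ℝ E₂ →ₗ[ℝ] F →ₗ[ℝ] E₁ →ₗ[ℝ] E₂ →ₗ[ℝ] F where
  toFun φ :=
    { toFun := fun ψ =>
        { toFun := fun f => LinearMap.smulRight (φ : E₁ →ₗ[ℝ] ℝ)
            (LinearMap.smulRight (ψ : E₂ →ₗ[ℝ] ℝ) f)
          map_add' := fun f g => by ext; simp
          map_smul' := fun c f => by ext; simp [smul_smul]; ring_nf }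
      map_add' := fun f g => by ext; simp [add_smul]
      map_smul' := fun c f => by ext; simp [smul_smul]; ring_nf }
  map_add' f g := by ext; simp [add_smul]
  map_smul' c f := by ext; simp [smul_smul]

theorem rankOne_apply (φ : StrongDual ℝ E₁) (ψ : StrongDual ℝ E₂) (f : F) (x : E₁) (y : E₂) :
    rankOne φ ψ f x y = φ x • ψ y • f := rfl

theorem isPositiveBilinear_rankOne {φ : StrongDual ℝ E₁} {ψ : StrongDual ℝ E₂} {f : F}
    (hφ : 0 ≤ φ) (hψ : 0 ≤ ψ) (hf : 0 ≤ f) : IsPositiveBilinear (rankOne φ ψ f) :=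
  fun x y hx hy => smul_nonneg (hφ x hx) (smul_nonneg (hψ y hy) hf)

theorem norm_rankOne_apply_le (φ : StrongDual ℝ E₁) (ψ : StrongDual ℝ E₂) (f : F) (x : E₁)
    (y : E₂) : ‖rankOne φ ψ f x y‖ ≤ ‖φ‖ * ‖ψ‖ * ‖f‖ * ‖x‖ * ‖y‖ := by
  rw [rankOne_apply, norm_smul, norm_smul]
  calc ‖φ x‖ * (‖ψ y‖ * ‖f‖) ≤ (‖φ‖ * ‖x‖) * ((‖ψ‖ * ‖y‖) * ‖f‖) := by
        gcongr
        · exact φ.le_opNorm x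
        · exact ψ.le_opNorm y
    _ = _ := by ring

theorem norm_mul_norm_mul_norm_le_of_rankOne {φ : StrongDual ℝ E₁} {ψ : StrongDual ℝ E₂} {f : F}
    {K : ℝ} (hK : 0 ≤ K) (h : ∀ x y, ‖rankOne φ ψ f x y‖ ≤ K * ‖x‖ * ‖y‖) :
    ‖φ‖ * ‖ψ‖ * ‖f‖ ≤ K := by
  have := ContinuousLinearMap.opNorm_le_bound₂ (φ.smulRight (ψ.smulRight f)) hK h
  rwa [ContinuousLinearMap.norm_smulRight_apply, ContinuousLinearMap.norm_smulRight_apply,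
    ← mul_assoc] at this

end RegularBilinear

open RegularBilinear in
/-- For nonzero Banach lattices `E₁`, `E₂`, `F` with `F` Dedekind complete, the space
`L^r(E₁, E₂; F)` with its regular norm has the positive Schur property if and only if the
duals of `E₁` and `E₂` and the lattice `F` have it. -/
theorem theorem4p2 {E₁ E₂ F : Type*}
    [NormedAddCommGroup E₁] [NormedSpace ℝ E₁] [Lattice E₁] [IsBanachLattice E₁] [Nontrivial E₁]
    [NormedAddCommGroup E₂] [NormedSpace ℝ E₂] [Lattice E₂] [IsBanachLattice E₂] [Nontrivial E₂]
    [NormedAddCommGroup F] [NormedSpace ℝ F] [Lattice F] [IsBanachLattice F] [Nontrivial F]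
    [IsDedekindComplete F] :
    HasPSP (RegularBilinear E₁ E₂ F) ↔
      HasPSP (StrongDual ℝ E₁) ∧ HasPSP (StrongDual ℝ E₂) ∧ HasPSP F := by
  refine ⟨fun h => ?_, fun h => hasPSP h.1 h.2.1 h.2.2⟩
  obtain ⟨φ, hφ, hφ0⟩ := StrongDual.exists_pos_ne_zero (E := E₁)
  obtain ⟨ψ, hψ, hψ0⟩ := StrongDual.exists_pos_ne_zero (E := E₂)
  obtain ⟨f, hf, hf0⟩ := exists_nonneg_ne_zero (E := F)
  have hφ' := norm_pos_iff.2 hφ0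
  have hψ' := norm_pos_iff.2 hψ0
  have hf' := norm_pos_iff.2 hf0
  refine ⟨?_, ?_, ?_⟩
  · refine hasPSP_of_embedding (C := ‖ψ‖ * ‖f‖) (c := (‖ψ‖ * ‖f‖)⁻¹)
      ((LinearMap.flip (rankOne (E₁ := E₁)) ψ).flip f)
      (fun χ hχ => isPositiveBilinear_rankOne hχ hψ hf) (by positivity) (fun χ a b => ?_)
      (fun χ K hK hle => ?_) h
    · refine (norm_rankOne_apply_le χ ψ f a b).trans_eq (by ring)
    · have := norm_mul_norm_mul_norm_le_of_rankOne hK hle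
      rw [le_inv_mul_iff₀ (by positivity)]
      linarith
  · refine hasPSP_of_embedding (C := ‖φ‖ * ‖f‖) (c := (‖φ‖ * ‖f‖)⁻¹)
      ((rankOne φ).flip f)
      (fun χ hχ => isPositiveBilinear_rankOne hφ hχ hf) (by positivity) (fun χ a b => ?_)
      (fun χ K hK hle => ?_) h
    · refine (norm_rankOne_apply_le φ χ f a b).trans_eq (by ring)
    · have := norm_mul_norm_mul_norm_le_of_rankOne hK hle
      rw [le_inv_mul_iff₀ (by positivity)]
      linarith
  · refine hasPSP_of_embedding (C := ‖φ‖ * ‖ψ‖) (c := (‖φ‖ * ‖ψ‖)⁻¹)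
      (rankOne φ ψ)
      (fun χ hχ => isPositiveBilinear_rankOne hφ hψ hχ) (by positivity) (fun χ a b => ?_)
      (fun χ K hK hle => ?_) h
    · exact norm_rankOne_apply_le φ ψ χ a b
    · have := norm_mul_norm_mul_norm_le_of_rankOne hK hle
      rw [le_inv_mul_iff₀ (by positivity)]
      linarith
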